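/- **Setting.** A temporal network $T=(V,E)$ consists of a finite set $V$ of $n\ge 2$ nodes and a finite set $E$ of directed edges $(u,v,t)$ with $u,v\in V$, $u\ne v$ and timestamp $t>0$. A *temporal walk* from $s$ to $z$ is a nonempty sequence of edges $(u_1,v_1,t_1),\dots,(u_k,v_k,t_k)$ of $E$ with $u_1=s$, $v_k=z$, $v_i=u_{i+1}$ and $t_i<t_{i+1}$ for $1\le i<k$; its length is $k$. It is a *temporal path* if no node is visited more than once, and it is *$\delta$-restless* if $t_{i+1}\le t_i+\delta$ for $1\le i<k$. Fix one of two optimality criteria: under STP, the set $\mathcal P_{s,z}$ of optimal paths consists of the temporal paths from $s$ to $z$ of minimum length; under RTP with parameter $\delta$, it consists of the $\delta$-restless temporal walks from $s$ to $z$ of minimum length among all such walks. Let $\sigma_{s,z}=|\mathcal P_{s,z}|$ and let $\sigma_{s,z}(v)$ be the number of elements of $\mathcal P_{s,z}$ that visit $v$, where $v\neq s,z$ (and $\sigma_{s,z}(v)=0$ if $v\in\{s,z\}$). The temporal betweenness centrality of $v\in V$ is $$b(v)=\frac1{n(n-1)}\sum_{s,z\in V,\ s\ne z}\frac{\sigma_{s,z}(v)}{\sigma_{s,z}},$$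 where a term with $\sigma_{s,z}=0$ counts as $0$. **Algorithm ONBRA.** On input $T$, $\eta\in(0,1)$ and an integer $\ell\ge 2$, ONBRA starts from the zero matrix $\tilde B\in\mathbb R^{V\times\{1,\dots,\ell\}}$. In each iteration $i=1,\dots,\ell$ it draws, independently of the previous draws, a pair $(s,z)$ uniformly at random from $\{(u,v)\in V^2:u\ne v\}$ and, if $\mathcal P_{s,z}\neq\emptyset$, sets $\tilde B_{v,i}=\sigma_{s,z}(v)/\sigma_{s,z}$ for every node $v$ internal to some element of $\mathcal P_{s,z}$. It returns $(\varepsilon',\tilde B(T))$, where $\tilde B(T)=\{(v,\tilde b(v)):v\in V\}$, $\tilde b(v)=\frac1\ell\sum_{i=1}^\ell\tilde B_{v,i}$ and $$\varepsilon'=\sup_{v\in V}\left\{\sqrt{\frac{2\,\mathbf V(\tilde B_{v,:})\ln(4n/\eta)}{\ell}}+\frac{7\ln(4n/\eta)}{3(\ell-1)}\right\},\qquad \mathbf V(\tilde B_{v,:})=\frac1{\ell(\ell-1)}\sum_{1\le i<j\le\ell}(\tilde B_{v,i}-\tilde B_{v,j})^2 .$$ **Corollary.** For every temporal network $T$ with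 at least two nodes, every $\eta\in(0,1)$, every integer $\ell\ge2$, and under both the STP criterion and the RTP criterion (for every $\delta$), the pair $(\varepsilon',\tilde B(T))$ returned by ONBRA satisfies $$\mathbb P\left[\sup_{v\in V}|\tilde b(v)-b(v)|\le\varepsilon'\right]>1-\eta ,$$ that is, $\tilde B(T)$ is an absolute $(\varepsilon',\eta)$-approximation set of $B(T)=\{(v,b(v)):v\in V\}$. -/

import Mathlib

open scoped BigOperators

/-- A directed edge `(u, v, t)` from `u = src` to `v = dst` with timestamp `t = time`. -/
structure TemporalEdge (V : Type*) where
  src : V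
  dst : V
  time : ℝ

/-- A temporal network on the node set `V`: a finite set of directed edges without self-loops and
with positive timestamps. -/
structure TemporalNetwork (V : Type*) where
  edges : Finset (TemporalEdge V)
  src_ne_dst : ∀ e ∈ edges, e.src ≠ e.dst
  time_pos : ∀ e ∈ edges, 0 < e.time

/-- The optimality criteria: shortest temporal paths (`stp`), and shortest `δ`-restless temporal
walks (`rtp δ`). -/
inductive PathCriterion where
  | stp : PathCriterion
  | rtp (δ : ℝ) : PathCriterion

/-- The set `𝒟` of ordered pairs of distinct nodes. -/
abbrev NodePair (V : Type*) : Type _ := {p : V × V // p.1 ≠ p.2}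

instance NodePair.instNonempty {V : Type*} [Nontrivial V] : Nonempty (NodePair V) :=
  let ⟨u, v, h⟩ := exists_pair_ne V
  ⟨⟨(u, v), h⟩⟩

namespace TemporalNetwork

variable {V : Type*}

/-- A temporal walk: a nonempty sequence of edges of the network, consecutive edges sharing the
intermediate node, with strictly increasing timestamps. -/
def IsWalk (T : TemporalNetwork V) (p : List (TemporalEdge V)) : Prop :=
  p ≠ [] ∧ (∀ e ∈ p, e ∈ T.edges) ∧ p.IsChain (fun e f => e.dst = f.src ∧ e.time < f.time)

/-- The sequence `u₁, v₁, v₂, …, v_k` of the nodes visited by `(u₁,v₁,t₁), …, (u_k,v_k,t_k)`. -/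
def visited : List (TemporalEdge V) → List V
  | [] => []
  | e :: p => e.src :: (e :: p).map TemporalEdge.dst

/-- A temporal path: a temporal walk that visits each node at most once. -/
def IsPath (T : TemporalNetwork V) (p : List (TemporalEdge V)) : Prop :=
  T.IsWalk p ∧ (visited p).Nodup

/-- `t_{i+1} ≤ t_i + δ` for all consecutive edges. -/
def IsRestless (δ : ℝ) (p : List (TemporalEdge V)) : Prop :=
  p.IsChain (fun e f => f.time ≤ e.time + δ)

/-- The sequence of edges starts at `s` and ends at `z`. -/
def Connects (s z : V) (p : List (TemporalEdge V)) : Prop :=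
  p.head?.map TemporalEdge.src = some s ∧ p.getLast?.map TemporalEdge.dst = some z

/-- The paths (for `stp`) or `δ`-restless walks (for `rtp δ`) from `s` to `z`. -/
def Admissible (T : TemporalNetwork V) (c : PathCriterion) (s z : V)
    (p : List (TemporalEdge V)) : Prop :=
  match c with
  | .stp => T.IsPath p ∧ Connects s z p
  | .rtp δ => T.IsWalk p ∧ IsRestless δ p ∧ Connects s z p

/-- The set `𝒫_{s,z}` of optimal paths: the admissible ones with the least number of edges. -/
def optimalPaths (T : TemporalNetwork V) (c : PathCriterion) (s z : V) :
    Set (List (TemporalEdge V)) :=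
  {p | T.Admissible c s z p ∧ ∀ q, T.Admissible c s z q → p.length ≤ q.length}

/-- The set of nodes internal to a path from `s` to `z`. -/
def internalNodes (s z : V) (p : List (TemporalEdge V)) : Set V :=
  {w | (∃ e ∈ p, e.src = w ∨ e.dst = w) ∧ w ≠ s ∧ w ≠ z}

/-- Timestamps increase along a walk, so no edge repeats and there are finitely many walks; in
particular the cardinalities below are counts of finite sets. -/
theorem finite_optimalPaths (T : TemporalNetwork V) (c : PathCriterion) (s z : V) :
    (T.optimalPaths c s z).Finite := by
  classical
  have hfin : {p : List (TemporalEdge V) | p.Nodup ∧ ∀ e ∈ p, e ∈ T.edges}.Finite := by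
    have h := (List.finite_length_le {e // e ∈ T.edges} T.edges.card).image
      (List.map Subtype.val)
    refine h.subset ?_
    rintro p ⟨hnd, hp⟩
    refine ⟨p.attach.map (fun e => ⟨e.1, hp e.1 e.2⟩), ?_, ?_⟩
    · have : p.toFinset ⊆ T.edges := fun e he => hp e (List.mem_toFinset.1 he)
      have h2 := Finset.card_le_card this
      rw [List.toFinset_card_of_nodup hnd] at h2
      simpa using h2
    · simp [List.map_map, Function.comp_def]
  refine hfin.subset ?_
  rintro p ⟨hp, -⟩
  have hw : T.IsWalk p := by
    cases c with
    | stp => exact hp.1.1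
    | rtp δ => exact hp.1
  refine ⟨?_, hw.2.1⟩
  have hc : p.IsChain (fun e f => e.time < f.time) := hw.2.2.imp (fun _ _ h => h.2)
  have : IsTrans (TemporalEdge V) (fun e f => e.time < f.time) := ⟨fun _ _ _ => lt_trans⟩
  exact (List.isChain_iff_pairwise.1 hc).imp (fun h he => by subst he; exact lt_irrefl _ h)

/-- `σ_{s,z}`, the number of optimal paths from `s` to `z`. -/
noncomputable def numPaths (T : TemporalNetwork V) (c : PathCriterion) (s z : V) : ℕ :=
  (T.optimalPaths c s z).ncard

/-- `σ_{s,z}(v)`, the number of optimal paths from `s` to `z` to which `v` is internal. -/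
noncomputable def numPathsThrough (T : TemporalNetwork V) (c : PathCriterion) (s z v : V) : ℕ :=
  {p ∈ T.optimalPaths c s z | v ∈ internalNodes s z p}.ncard

/-- The temporal betweenness centrality `b(v)`. A pair with `σ_{s,z} = 0` contributes `0`. -/
noncomputable def betweenness [Fintype V] [DecidableEq V] (T : TemporalNetwork V)
    (c : PathCriterion) (v : V) : ℝ :=
  1 / ((Fintype.card V : ℝ) * ((Fintype.card V : ℝ) - 1)) *
    ∑ d : NodePair V, (T.numPathsThrough c d.1.1 d.1.2 v : ℝ) / (T.numPaths c d.1.1 d.1.2 : ℝ)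

end TemporalNetwork

namespace ONBRA

variable {V : Type*}

/-- The empirical variance of `x₁, …, x_ℓ`. -/
noncomputable def empiricalVariance {ℓ : ℕ} (x : Fin ℓ → ℝ) : ℝ :=
  1 / ((ℓ : ℝ) * ((ℓ : ℝ) - 1)) * ∑ i : Fin ℓ, ∑ j ∈ Finset.Ioi i, (x i - x j) ^ 2

open Classical in
/-- Processing the pair `(s, z)` sampled in iteration `i`: if `z` is reached from `s`, then for
every node `v` internal to an optimal path the entry `(v, i)` of the matrix of estimates is set
to `σ_{s,z}(v) / σ_{s,z}`; all the other entries are kept. -/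
noncomputable def processSample {ℓ : ℕ} (T : TemporalNetwork V) (c : PathCriterion)
    (i : Fin ℓ) (d : NodePair V) (B : V → Fin ℓ → ℝ) : V → Fin ℓ → ℝ :=
  if (T.optimalPaths c d.1.1 d.1.2).Nonempty then
    fun v j =>
      if j = i ∧ ∃ p ∈ T.optimalPaths c d.1.1 d.1.2, v ∈ TemporalNetwork.internalNodes d.1.1 d.1.2 p
      then (T.numPathsThrough c d.1.1 d.1.2 v : ℝ) / (T.numPaths c d.1.1 d.1.2 : ℝ)
      else B v j
  else B

/-- The main loop: starting from the zero matrix, each of the `ℓ` iterations draws a fresh pair of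
distinct nodes uniformly at random and processes it. The result is the law of the final matrix of
estimates. -/
noncomputable def estimates [Fintype V] [DecidableEq V] [Nontrivial V] (T : TemporalNetwork V)
    (c : PathCriterion) (ℓ : ℕ) : PMF (V → Fin ℓ → ℝ) :=
  (List.finRange ℓ).foldlM
    (fun B i => (PMF.uniformOfFintype (NodePair V)).bind fun d =>
      PMF.pure (processSample T c i d B))
    (fun _ _ => 0)

/-- The returned estimates: row averages of the matrix. -/
noncomputable def average {ℓ : ℕ} (B : V → Fin ℓ → ℝ) (v : V) : ℝ :=
  1 / (ℓ : ℝ) * ∑ i : Fin ℓ, B v i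

/-- The returned accuracy `ε'`, computed from the matrix of estimates. -/
noncomputable def accuracy [Fintype V] {ℓ : ℕ} (η : ℝ) (B : V → Fin ℓ → ℝ) : ℝ :=
  ⨆ v : V, (Real.sqrt (2 * empiricalVariance (B v) * Real.log (4 * (Fintype.card V : ℝ) / η) / ℓ)
    + 7 * Real.log (4 * (Fintype.card V : ℝ) / η) / (3 * ((ℓ : ℝ) - 1)))

/-- The randomized algorithm: the law of the returned pair of the accuracy and the estimates. -/
noncomputable def onbra [Fintype V] [DecidableEq V] [Nontrivial V] (T : TemporalNetwork V)
    (c : PathCriterion) (η : ℝ) (ℓ : ℕ) : PMF (ℝ × (V → ℝ)) :=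
  (estimates T c ℓ).bind fun B => PMF.pure (accuracy η B, average B)

end ONBRA

open Finset

/-! ### Elementary inequalities for the exponential -/

/-! Row `v` of the final matrix consists of `ℓ` independent uniform draws of a `[0,1]`-valued
function, `ONBRA.pathFraction`, whose mean is `b(v)`. The theorem is therefore an empirical
Bernstein inequality for each row, followed by a union bound over the nodes.

Put `L = ln(4n/η)`. For each node, three bad events have probability at most `e^{-L} = η/(4n)` each:
the upper and the lower deviation in Bernstein's inequality with the true variance
(`card_filter_sum_gt_le_bernstein`), and the empirical variance falling far below the true one
(`card_filter_empiricalVariance_lt_le`). Off these events the empirical variance can replace the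
true one at the cost of a term of order `L/(ℓ-1)`. The total failure probability is at most `3η/4 <
η`.

The variance tail uses Hoeffding's device for U-statistics: the empirical variance is an average
over permutations of means over disjoint, hence independent, pairs, and Jensen's inequality reduces
its exponential moment to that of one such mean.

Probabilities are handled as counts of vectors of draws; `PMF.foldlM_uniformOfFintype_eq_map`
transfers the counts to the loop. -/

theorem Real.exp_neg_le_quadratic {x : ℝ} (hx : 0 ≤ x) : Real.exp (-x) ≤ 1 - x + x ^ 2 / 2 := by
  have h1 := Real.quadratic_le_exp_of_nonneg hx
  have h2 : Real.exp (-x) * Real.exp x = 1 := by rw [← Real.exp_add]; simp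
  have h3 : 0 < Real.exp (-x) := Real.exp_pos _
  have h4 : Real.exp (-x) * (1 + x + x ^ 2 / 2) ≤ 1 := 
    (mul_le_mul_of_nonneg_left h1 h3.le).trans_eq h2
  -- The product equals `1 + x ^ 4 / 4`.
  have h5 : 1 ≤ (1 - x + x ^ 2 / 2) * (1 + x + x ^ 2 / 2) := by nlinarith [sq_nonneg (x ^ 2)]
  exact le_of_mul_le_mul_right (h4.trans h5) (by positivity)

/-- The exponential is at most its `[2/1]` Padé approximant on `[0, 3)`. -/
theorem Real.exp_mul_one_sub_div_three_le {x : ℝ} (hx : 0 ≤ x) :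
    Real.exp x * (1 - x / 3) ≤ 1 + 2 * x / 3 + x ^ 2 / 6 := by
  -- This function is `1` at `0` and nondecreasing on `[0, ∞)`, since `1 + y + y ^ 2 / 2 ≤ exp y`;
  -- multiplying by `exp x` gives the claim.
  have hd : ∀ y : ℝ, HasDerivAt (fun y : ℝ => Real.exp (-y) * (1 + 2 * y / 3 + y ^ 2 / 6) + y / 3)
      ((1 - Real.exp (-y) * (1 + y + y ^ 2 / 2)) / 3) y := by
    intro y
    have h1 : HasDerivAt (fun y : ℝ => Real.exp (-y)) (Real.exp (-y) * (-1)) y :=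
      (hasDerivAt_neg y).exp
    have h2 : HasDerivAt (fun y : ℝ => 1 + 2 * y / 3 + y ^ 2 / 6) (2 / 3 + 2 * y / 6) y := by
      have a := (((hasDerivAt_id y).const_mul 2).div_const 3).const_add 1
      have b := ((hasDerivAt_id y).pow 2).div_const 6
      exact (a.add b).congr_deriv (by simp)
    exact ((h1.mul h2).add ((hasDerivAt_id y).div_const 3)).congr_deriv (by ring)
  have hmono := monotoneOn_of_deriv_nonneg (convex_Ici (0 : ℝ))
    (f := fun y : ℝ => Real.exp (-y) * (1 + 2 * y / 3 + y ^ 2 / 6) + y / 3)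
    (fun y _ => (hd y).continuousAt.continuousWithinAt)
    (fun y _ => (hd y).differentiableAt.differentiableWithinAt) (by
      intro y hy
      rw [interior_Ici] at hy
      rw [(hd y).deriv]
      have h1 := Real.quadratic_le_exp_of_nonneg (le_of_lt hy)
      have h2 : Real.exp (-y) * Real.exp y = 1 := by rw [← Real.exp_add]; simp
      have h4 : Real.exp (-y) * (1 + y + y ^ 2 / 2) ≤ 1 :=
        (mul_le_mul_of_nonneg_left h1 (Real.exp_pos _).le).trans_eq h2
      linarith)
  have h := hmono (Set.mem_Ici.2 le_rfl) (Set.mem_Ici.2 hx) hx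
  simp only [neg_zero, Real.exp_zero] at h
  have h2 : Real.exp x * Real.exp (-x) = 1 := by rw [← Real.exp_add]; simp
  have h3 := mul_le_mul_of_nonneg_left h (Real.exp_pos x).le
  linear_combination h3 + (1 + 2 * x / 3 + x ^ 2 / 6) * h2

theorem Real.exp_le_one_add_add_sq_div {x y : ℝ} (hxy : x ≤ y) (hy0 : 0 ≤ y) (hy : y < 3) :
    Real.exp x ≤ 1 + x + x ^ 2 / (2 * (1 - y / 3)) := by
  have hy' : 0 < 1 - y / 3 := by linarith
  rcases le_total 0 x with hx | hx
  · have hx' : 0 < 1 - x / 3 := by linarith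
    have h1 : Real.exp x ≤ 1 + x + x ^ 2 / (2 * (1 - x / 3)) := by
      have := (le_div_iff₀ hx').2 (Real.exp_mul_one_sub_div_three_le hx)
      refine this.trans_eq ?_
      have : (1 - x / 3) ≠ 0 := hx'.ne'
      have : (3 - x) ≠ 0 := by linarith
      field_simp
      ring
    refine h1.trans ?_
    gcongr
  · have h1 := Real.exp_neg_le_quadratic (neg_nonneg.2 hx)
    rw [neg_neg] at h1
    have h2 : x ^ 2 / 2 ≤ x ^ 2 / (2 * (1 - y / 3)) :=
      div_le_div_of_nonneg_left (sq_nonneg _) (by positivity) (by linarith)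
    linarith

/-! ### Counting form of the Chernoff bound -/

section Counting

variable {D : Type*} [Fintype D]

open Classical in
-- Markov's inequality for `exp (s * S)`, without normalization.
theorem card_filter_lt_le_sum_exp {Ω : Type*} [Fintype Ω] (S : Ω → ℝ) (t s : ℝ) (hs : 0 ≤ s) :
    (#{ω | t < S ω} : ℝ) ≤ (∑ ω, Real.exp (s * S ω)) * Real.exp (-(s * t)) := by
  rw [Finset.sum_mul, Finset.card_eq_sum_ones, Nat.cast_sum, Finset.sum_filter]
  refine Finset.sum_le_sum fun ω _ => ?_
  rw [← Real.exp_add]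
  split_ifs with h
  · rw [Nat.cast_one]
    apply Real.one_le_exp
    nlinarith
  · positivity

theorem sum_exp_sum_eq_pow (n : ℕ) (f : D → ℝ) :
    ∑ ω : Fin n → D, Real.exp (∑ i, f (ω i)) = (∑ d, Real.exp (f d)) ^ n := by
  rw [Fintype.sum_pow]
  exact Finset.sum_congr rfl fun ω _ => Real.exp_sum _ _

/-- Centring kills the linear term of the expansion, and `1 + u ≤ exp u` restores an exponential.
Only an upper bound on `f` is needed, because the bound on `exp` is one-sided. -/
theorem sum_exp_mul_le_of_sum_eq_zero [Nonempty D] (f : D → ℝ) (hf : ∀ d, f d ≤ 1)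
    (h0 : ∑ d, f d = 0) {s : ℝ} (hs0 : 0 ≤ s) (hs : s < 3) :
    ∑ d, Real.exp (s * f d) ≤ Fintype.card D *
      Real.exp (s ^ 2 / (2 * (1 - s / 3)) * ((∑ d, f d ^ 2) / Fintype.card D)) := by
  have hN : (0 : ℝ) < Fintype.card D := by exact_mod_cast Fintype.card_pos
  calc ∑ d, Real.exp (s * f d)
      ≤ ∑ d, (1 + s * f d + (s * f d) ^ 2 / (2 * (1 - s / 3))) :=
        Finset.sum_le_sum fun d _ => Real.exp_le_one_add_add_sq_div
          (by nlinarith [hf d]) hs0 hs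
    _ = Fintype.card D *
          (s ^ 2 / (2 * (1 - s / 3)) * ((∑ d, f d ^ 2) / Fintype.card D) + 1) := by
        simp only [Finset.sum_add_distrib, mul_pow, ← Finset.mul_sum, ← Finset.sum_div, h0]
        simp only [sum_const, card_univ, nsmul_eq_mul, mul_one, mul_zero, add_zero]
        field_simp
        ring
    _ ≤ _ := by gcongr; exact Real.add_one_le_exp _

open Classical in
/-- **Bernstein's inequality** for the uniform distribution on a finite set. -/
theorem card_filter_sum_gt_le_bernstein [Nonempty D] (n : ℕ) (f : D → ℝ) (hf : ∀ d, f d ≤ 1)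
    (h0 : ∑ d, f d = 0) {L v : ℝ} (hL : 0 < L) (hv : v = (∑ d, f d ^ 2) / Fintype.card D) :
    (#{ω : Fin n → D | √(2 * (n * v) * L) + L / 3 < ∑ i, f (ω i)} : ℝ)
      ≤ (Fintype.card D : ℝ) ^ n * Real.exp (-L) := by
  have hN : (0 : ℝ) < Fintype.card D := by exact_mod_cast Fintype.card_pos
  have hv0 : 0 ≤ v := hv ▸ by positivity
  -- With zero total variance the sum vanishes identically, and the optimal `s` below would divide
  -- by zero.
  rcases (mul_nonneg (Nat.cast_nonneg n) hv0).eq_or_lt with hnv | hnv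
  · have hempty : ∀ ω : Fin n → D, ∑ i, f (ω i) = 0 := by
      rcases mul_eq_zero.1 hnv.symm with h | h
      · have : n = 0 := by exact_mod_cast h
        subst this
        simp
      · rw [hv, div_eq_zero_iff, or_iff_left hN.ne',
          Finset.sum_eq_zero_iff_of_nonneg (fun d _ => sq_nonneg _)] at h
        intro ω
        exact Finset.sum_eq_zero fun i _ => by simpa using h (ω i) (mem_univ _)
    rw [Finset.filter_false_of_mem]
    · simp; positivity
    · intro ω _
      rw [hempty, not_lt]
      positivity
  · set w : ℝ := n * v with hw
    -- In terms of `r` the square roots disappear: `L = w r² / 2` and the threshold is `w r + w r² /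
    -- 6`.
    set r : ℝ := √(2 * L / w) with hr
    have hr0 : 0 < r := Real.sqrt_pos.2 (by positivity)
    have hrsq : r ^ 2 = 2 * L / w := Real.sq_sqrt (by positivity)
    have hLr : L = w * r ^ 2 / 2 := by rw [hrsq]; field_simp
    have hsq : √(2 * w * L) = w * r := by
      rw [hLr, show 2 * w * (w * r ^ 2 / 2) = (w * r) ^ 2 by ring]
      exact Real.sqrt_sq (by positivity)
    -- Chosen so that `1 - s / 3 = 1 / (1 + r / 3)`; the exponent then equals exactly `-L`.
    set s : ℝ := r / (1 + r / 3) with hs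
    have hs0 : 0 ≤ s := by positivity
    have hs3 : s < 3 := by rw [hs, div_lt_iff₀ (by positivity)]; linarith
    refine (card_filter_lt_le_sum_exp _ _ s hs0).trans ?_
    simp only [Finset.mul_sum]
    rw [sum_exp_sum_eq_pow n (fun d => s * f d)]
    have h1 := pow_le_pow_left₀ (Finset.sum_nonneg fun d _ => (Real.exp_pos _).le)
      (sum_exp_mul_le_of_sum_eq_zero f hf h0 hs0 hs3) n
    rw [mul_pow, ← Real.exp_nat_mul, ← hv] at h1
    refine (mul_le_mul_of_nonneg_right h1 (Real.exp_pos _).le).trans_eq ?_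
    rw [mul_assoc, ← Real.exp_add, hsq]
    congr 2
    have h3 : (n : ℝ) * (s ^ 2 / (2 * (1 - s / 3)) * v) = s ^ 2 / (2 * (1 - s / 3)) * w := by
      rw [hw]; ring
    have h4 : 1 - s / 3 = 1 / (1 + r / 3) := by rw [hs]; field_simp; ring
    rw [h3, h4, hs, hLr]
    field_simp
    ring

/-! ### Lower tail of the sample variance -/

/-- Summing over all permutations the value of a function at the images of two distinct points
gives, up to normalization, the sum over all ordered pairs of distinct points. -/
theorem sum_perm_apply_pair {ι : Type*} [Fintype ι] [DecidableEq ι] (F : ι → ι → ℝ)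
    {a b : ι} (hab : a ≠ b) :
    (#(univ : Finset ι).offDiag : ℝ) * ∑ π : Equiv.Perm ι, F (π a) (π b) =
      Fintype.card (Equiv.Perm ι) * ∑ p ∈ (univ : Finset ι).offDiag, F p.1 p.2 := by
  -- The symmetric group is doubly transitive, so the sum over `π` is the same for every pair;
  -- counting over `π` and pairs in both orders finishes.
  have hconst : ∀ p ∈ (univ : Finset ι).offDiag,
      ∑ π : Equiv.Perm ι, F (π p.1) (π p.2) = ∑ π : Equiv.Perm ι, F (π a) (π b) := by
    rintro ⟨c, d⟩ hcd
    have hcd' : c ≠ d := by simpa using hcd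
    obtain ⟨ρ, hρc, hρd⟩ : ∃ ρ : Equiv.Perm ι, ρ a = c ∧ ρ b = d := by
      -- The inner swap sends `a` to `c`; the outer one sends the image of `b` to `d` and fixes `c`.
      refine ⟨Equiv.swap (Equiv.swap a c b) d * Equiv.swap a c, ?_, ?_⟩
      · rw [Equiv.Perm.mul_apply, Equiv.swap_apply_left]
        refine Equiv.swap_apply_of_ne_of_ne ?_ hcd'
        intro h
        apply hab
        apply (Equiv.swap a c).injective
        rw [Equiv.swap_apply_left, ← h]
      · rw [Equiv.Perm.mul_apply, Equiv.swap_apply_left]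
    rw [← Equiv.sum_comp (Equiv.mulRight ρ) fun π : Equiv.Perm ι => F (π a) (π b)]
    simp [hρc, hρd]
  have hperm : ∀ π : Equiv.Perm ι, ∑ p ∈ (univ : Finset ι).offDiag, F (π p.1) (π p.2) =
      ∑ p ∈ (univ : Finset ι).offDiag, F p.1 p.2 := by
    intro π
    refine Finset.sum_equiv (Equiv.prodCongr π π) ?_ ?_ <;> simp
  rw [← nsmul_eq_mul, ← Finset.sum_const, ← Finset.sum_congr rfl hconst, Finset.sum_comm,
    Finset.sum_congr rfl fun π _ => hperm π, Finset.sum_const, nsmul_eq_mul, card_univ]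

/-- Half the squared difference of two independent draws has mean `v` and lies in `[0, 1/2]`, so its
second moment is at most `v / 2`. This self-bounding makes the quadratic term proportional to `v`.
-/
theorem sum_sum_exp_neg_mul_sq_sub_le [Nonempty D] (f : D → ℝ) (hf0 : ∀ d, 0 ≤ f d)
    (hf1 : ∀ d, f d ≤ 1) {μ v s : ℝ} (hμ : μ = (∑ d, f d) / Fintype.card D)
    (hv : v = (∑ d, (f d - μ) ^ 2) / Fintype.card D) (hs : 0 ≤ s) :
    ∑ d, ∑ e, Real.exp (-(s * ((f d - f e) ^ 2 / 2))) ≤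
      (Fintype.card D : ℝ) ^ 2 * Real.exp (-(s * v) + s ^ 2 * v / 4) := by
  have hN : (0 : ℝ) < Fintype.card D := by exact_mod_cast Fintype.card_pos
  have hmean : ∑ d, (f d - μ) = 0 := by
    rw [Finset.sum_sub_distrib, hμ]
    simp only [sum_const, card_univ, nsmul_eq_mul]
    field_simp
    ring
  have hsum : ∑ d, ∑ e, (f d - f e) ^ 2 = 2 * (Fintype.card D : ℝ) ^ 2 * v := by
    have h1 : ∀ d, ∑ e, (f d - f e) ^ 2 =
        Fintype.card D * (f d - μ) ^ 2 + ∑ e, (f e - μ) ^ 2 := by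
      intro d
      have : ∀ e, (f d - f e) ^ 2 = (f d - μ) ^ 2 + (f e - μ) ^ 2 - 2 * (f d - μ) * (f e - μ) :=
        fun e => by ring
      simp only [this, Finset.sum_sub_distrib, Finset.sum_add_distrib, ← Finset.mul_sum, hmean]
      simp
    simp only [h1, Finset.sum_add_distrib, ← Finset.mul_sum]
    rw [hv]
    simp only [sum_const, card_univ, nsmul_eq_mul]
    field_simp
    ring
  have hpt : ∀ d e, Real.exp (-(s * ((f d - f e) ^ 2 / 2))) ≤
      1 + (-(s / 2) + s ^ 2 / 8) * (f d - f e) ^ 2 := by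
    intro d e
    have h1 := Real.exp_neg_le_quadratic (x := s * ((f d - f e) ^ 2 / 2)) (by positivity)
    have h2 : (f d - f e) ^ 2 ≤ 1 := by
      rw [sq_le_one_iff_abs_le_one, abs_le]
      constructor <;> linarith [hf0 d, hf1 d, hf0 e, hf1 e]
    have h3 : ((f d - f e) ^ 2) ^ 2 ≤ (f d - f e) ^ 2 := by nlinarith [sq_nonneg (f d - f e)]
    have h4 := mul_le_mul_of_nonneg_left h3 (show 0 ≤ s ^ 2 / 8 by positivity)
    linear_combination h1 + h4
  calc ∑ d, ∑ e, Real.exp (-(s * ((f d - f e) ^ 2 / 2)))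
      ≤ ∑ d, ∑ e, (1 + (-(s / 2) + s ^ 2 / 8) * (f d - f e) ^ 2) :=
        Finset.sum_le_sum fun d _ => Finset.sum_le_sum fun e _ => hpt d e
    _ = (Fintype.card D : ℝ) ^ 2 * ((-(s * v) + s ^ 2 * v / 4) + 1) := by
        simp only [Finset.sum_add_distrib, ← Finset.mul_sum, hsum]
        simp only [sum_const, card_univ, nsmul_eq_mul]
        ring
    _ ≤ _ := by gcongr; exact Real.add_one_le_exp _

/-- Factorization over disjoint pairs of coordinates. -/
theorem sum_prod_disjoint_pairs {m r n : ℕ} (e : (Fin m ⊕ Fin m) ⊕ Fin r ≃ Fin n)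
    (g : D → D → ℝ) :
    ∑ ω : Fin n → D, ∏ k : Fin m, g (ω (e (.inl (.inl k)))) (ω (e (.inl (.inr k)))) =
      (Fintype.card D : ℝ) ^ r * (∑ d, ∑ d', g d d') ^ m := by
  rw [← Equiv.sum_comp (Equiv.arrowCongr e (Equiv.refl D))]
  simp only [Equiv.arrowCongr_apply, Function.comp_apply, Equiv.symm_apply_apply,
    Equiv.refl_apply]
  rw [← Equiv.sum_comp (Equiv.sumArrowEquivProdArrow (Fin m ⊕ Fin m) (Fin r) D).symm,
    Fintype.sum_prod_type, ← Equiv.sum_comp (Equiv.sumArrowEquivProdArrow (Fin m) (Fin m) D).symm]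
  simp only [Equiv.sumArrowEquivProdArrow_symm_apply_inl,
    sum_const, card_univ, nsmul_eq_mul]
  rw [← Finset.mul_sum, ← Fintype.sum_prod_type', Fintype.sum_pow,
    ← Equiv.sum_comp (Equiv.arrowProdEquivProdArrow (Fin m) (fun _ => D) (fun _ => D))]
  simp

theorem ONBRA.empiricalVariance_eq_sum_offDiag {n : ℕ} (x : Fin n → ℝ) :
    ONBRA.empiricalVariance x = 1 / ((n : ℝ) * ((n : ℝ) - 1)) *
      ∑ p ∈ (univ : Finset (Fin n)).offDiag, (x p.1 - x p.2) ^ 2 / 2 := by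
  have hle : ∑ i : Fin n, ∑ j ∈ Finset.Ioi i, (x i - x j) ^ 2 =
      ∑ p : Fin n × Fin n with p.1 < p.2, (x p.1 - x p.2) ^ 2 := by
    rw [Finset.sum_filter, Fintype.sum_prod_type]
    refine Finset.sum_congr rfl fun i _ => ?_
    rw [← Finset.sum_filter]
    refine Finset.sum_congr ?_ fun _ _ => rfl
    ext j; simp
  have hgt : ∑ p : Fin n × Fin n with p.2 < p.1, (x p.1 - x p.2) ^ 2 =
      ∑ p : Fin n × Fin n with p.1 < p.2, (x p.1 - x p.2) ^ 2 := by
    refine Finset.sum_equiv (Equiv.prodComm _ _) (by simp) ?_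
    intro p _
    simp only [Equiv.prodComm_apply, Prod.fst_swap, Prod.snd_swap]
    ring
  have hsplit : (univ : Finset (Fin n)).offDiag =
      (univ.filter fun p : Fin n × Fin n => p.1 < p.2) ∪
        univ.filter fun p : Fin n × Fin n => p.2 < p.1 := by
    ext p
    simp [lt_or_lt_iff_ne]
  have hdisj : Disjoint (univ.filter fun p : Fin n × Fin n => p.1 < p.2)
      (univ.filter fun p : Fin n × Fin n => p.2 < p.1) := by
    rw [Finset.disjoint_filter]
    exact fun p _ h => h.not_gt
  rw [ONBRA.empiricalVariance, hle, ← Finset.sum_div, hsplit, Finset.sum_union hdisj, hgt]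
  ring

theorem ONBRA.empiricalVariance_nonneg {n : ℕ} (hn : 2 ≤ n) (x : Fin n → ℝ) :
    0 ≤ ONBRA.empiricalVariance x := by
  have : (2 : ℝ) ≤ n := by exact_mod_cast hn
  have : 0 ≤ (n : ℝ) - 1 := by linarith
  unfold ONBRA.empiricalVariance
  exact mul_nonneg (by positivity)
    (Finset.sum_nonneg fun i _ => Finset.sum_nonneg fun j _ => sq_nonneg _)

/-- The empirical variance is the average, over all permutations of the sample, of a mean of
functions of disjoint pairs of the sample. -/
theorem ONBRA.mul_empiricalVariance_eq_perm_average {m r n : ℕ}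
    (e : (Fin m ⊕ Fin m) ⊕ Fin r ≃ Fin n) (hn : 2 ≤ n) (x : Fin n → ℝ) :
    m * ONBRA.empiricalVariance x = ∑ π : Equiv.Perm (Fin n),
      (1 / Fintype.card (Equiv.Perm (Fin n)) : ℝ) *
        ∑ k, (x (π (e (.inl (.inl k)))) - x (π (e (.inl (.inr k))))) ^ 2 / 2 := by
  have hn' : (2 : ℝ) ≤ n := by exact_mod_cast hn
  have hn1 : (n : ℝ) - 1 ≠ 0 := by linarith
  have hn0 : (n : ℝ) ≠ 0 := by linarith
  have hP : (Fintype.card (Equiv.Perm (Fin n)) : ℝ) ≠ 0 := by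
    exact_mod_cast Fintype.card_ne_zero
  have hcard : (#(univ : Finset (Fin n)).offDiag : ℝ) = n * (n - 1) := by
    rw [Finset.offDiag_card, card_univ, Fintype.card_fin, Nat.cast_sub (Nat.le_mul_self n)]
    push_cast
    ring
  -- Averaged over all permutations, each single pair already yields the full empirical variance.
  have hk : ∀ k : Fin m, ∑ π : Equiv.Perm (Fin n),
      (x (π (e (.inl (.inl k)))) - x (π (e (.inl (.inr k))))) ^ 2 / 2 =
        Fintype.card (Equiv.Perm (Fin n)) * ONBRA.empiricalVariance x := by
    intro k
    have h := sum_perm_apply_pair (fun i j => (x i - x j) ^ 2 / 2)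
      (a := e (.inl (.inl k))) (b := e (.inl (.inr k))) (by simp)
    rw [hcard] at h
    rw [ONBRA.empiricalVariance_eq_sum_offDiag]
    field_simp
    simp only [← Finset.sum_div] at h ⊢
    field_simp at h
    linarith
  rw [← Finset.mul_sum, Finset.sum_comm, Finset.sum_congr rfl fun k _ => hk k]
  simp only [sum_const, card_univ, Fintype.card_fin, nsmul_eq_mul]
  field_simp

/-- Jensen moves the average over permutations outside `exp`. Permuting coordinates preserves the
sum over `ω`, so one arrangement suffices, and there the disjoint pairs factorize. -/
theorem sum_exp_neg_empiricalVariance_le [Nonempty D] {m r n : ℕ}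
    (e : (Fin m ⊕ Fin m) ⊕ Fin r ≃ Fin n) (hn : 2 ≤ n)
    (f : D → ℝ) (hf0 : ∀ d, 0 ≤ f d)
    (hf1 : ∀ d, f d ≤ 1) {μ v s : ℝ} (hμ : μ = (∑ d, f d) / Fintype.card D)
    (hv : v = (∑ d, (f d - μ) ^ 2) / Fintype.card D) (hs : 0 ≤ s) :
    ∑ ω : Fin n → D, Real.exp (s * -(m * ONBRA.empiricalVariance fun i => f (ω i))) ≤
      (Fintype.card D : ℝ) ^ n * Real.exp (m * (-(s * v) + s ^ 2 * v / 4)) := by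
  have hP : (0 : ℝ) < Fintype.card (Equiv.Perm (Fin n)) := by
    exact_mod_cast Fintype.card_pos
  set W : (Fin n → D) → ℝ := fun ω =>
    ∑ k, (f (ω (e (.inl (.inl k)))) - f (ω (e (.inl (.inr k))))) ^ 2 / 2 with hW
  have hjensen : ∀ ω : Fin n → D,
      Real.exp (s * -(m * ONBRA.empiricalVariance fun i => f (ω i))) ≤
        ∑ π : Equiv.Perm (Fin n), (1 / Fintype.card (Equiv.Perm (Fin n)) : ℝ) *
          Real.exp (-(s * W (ω ∘ π))) := by
    intro ω
    have h := convexOn_exp.map_sum_le (t := (univ : Finset (Equiv.Perm (Fin n))))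
      (w := fun _ => (1 / Fintype.card (Equiv.Perm (Fin n)) : ℝ))
      (p := fun π => -(s * W (ω ∘ π))) (fun _ _ => by positivity)
      (by rw [Finset.sum_const, card_univ, nsmul_eq_mul]; field_simp) (fun _ _ => Set.mem_univ _)
    simp only [smul_eq_mul] at h
    refine le_of_eq_of_le ?_ h
    rw [ONBRA.mul_empiricalVariance_eq_perm_average e hn, mul_neg, Finset.mul_sum,
      ← Finset.sum_neg_distrib]
    congr 1
    refine Finset.sum_congr rfl fun π _ => ?_
    simp only [hW, Function.comp_apply]
    ring
  have hinv : ∀ π : Equiv.Perm (Fin n), ∑ ω : Fin n → D, Real.exp (-(s * W (ω ∘ π))) =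
      ∑ ω : Fin n → D, Real.exp (-(s * W ω)) := fun π =>
    Equiv.sum_comp (Equiv.arrowCongr π.symm (Equiv.refl D)) fun ω => Real.exp (-(s * W ω))
  have hnm : n = r + 2 * m := by
    have := Fintype.card_congr e
    simp at this
    omega
  calc ∑ ω : Fin n → D, Real.exp (s * -(m * ONBRA.empiricalVariance fun i => f (ω i)))
      ≤ ∑ ω : Fin n → D, ∑ π : Equiv.Perm (Fin n),
          (1 / Fintype.card (Equiv.Perm (Fin n)) : ℝ) * Real.exp (-(s * W (ω ∘ π))) :=
        Finset.sum_le_sum fun ω _ => hjensen ω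
    _ = ∑ ω : Fin n → D, Real.exp (-(s * W ω)) := by
        rw [Finset.sum_comm]
        simp only [← Finset.mul_sum, hinv, sum_const, card_univ, nsmul_eq_mul]
        field_simp
    _ = (Fintype.card D : ℝ) ^ r *
          (∑ d, ∑ d', Real.exp (-(s * ((f d - f d') ^ 2 / 2)))) ^ m := by
        rw [← sum_prod_disjoint_pairs e]
        refine Finset.sum_congr rfl fun ω _ => ?_
        rw [← Real.exp_sum, hW, Finset.mul_sum, Finset.sum_neg_distrib]
    _ ≤ (Fintype.card D : ℝ) ^ r *
          ((Fintype.card D : ℝ) ^ 2 * Real.exp (-(s * v) + s ^ 2 * v / 4)) ^ m := by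
        gcongr
        exact sum_sum_exp_neg_mul_sq_sub_le f hf0 hf1 hμ hv hs
    _ = _ := by
        rw [mul_pow, ← Real.exp_nat_mul, ← mul_assoc, ← pow_mul, ← pow_add, hnm]

open Classical in
/-- The lower tail of the empirical variance. -/
theorem card_filter_empiricalVariance_lt_le [Nonempty D] {n : ℕ} (hn : 2 ≤ n)
    (f : D → ℝ) (hf0 : ∀ d, 0 ≤ f d)
    (hf1 : ∀ d, f d ≤ 1) {μ v L : ℝ} (hμ : μ = (∑ d, f d) / Fintype.card D)
    (hv : v = (∑ d, (f d - μ) ^ 2) / Fintype.card D) (hL : 0 < L) :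
    (#{ω : Fin n → D | (ONBRA.empiricalVariance fun i => f (ω i)) <
        v - √v * √(2 * L / (n - 1))} : ℝ) ≤
      (Fintype.card D : ℝ) ^ n * Real.exp (-L) := by
  have hn' : (2 : ℝ) ≤ n := by exact_mod_cast hn
  have hn1 : 0 < (n : ℝ) - 1 := by linarith
  have hN : (0 : ℝ) < Fintype.card D := by exact_mod_cast Fintype.card_pos
  have hv0 : 0 ≤ v := hv ▸ by positivity
  -- For odd `n` one coordinate stays unpaired; `2 * m ≥ n - 1` is the source of `n - 1` in the
  -- bound.
  obtain ⟨m, r, hnm, hr⟩ : ∃ m r : ℕ, n = (m + m) + r ∧ r ≤ 1 :=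
    ⟨n / 2, n % 2, by omega, by omega⟩
  have hm : 0 < m := by omega
  have hm' : (0 : ℝ) < m := by exact_mod_cast hm
  have hnm' : (n : ℝ) - 1 ≤ 2 * m := by
    have : n ≤ 2 * m + 1 := by omega
    have : (n : ℝ) ≤ 2 * m + 1 := by exact_mod_cast this
    linarith
  have e : (Fin m ⊕ Fin m) ⊕ Fin r ≃ Fin n :=
    ((finSumFinEquiv.sumCongr (Equiv.refl _)).trans finSumFinEquiv).trans (finCongr hnm.symm)
  rcases hv0.eq_or_lt with h0 | hpos
  · rw [Finset.filter_false_of_mem]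
    · simp; positivity
    · intro ω _
      rw [← h0, not_lt]
      simpa using ONBRA.empiricalVariance_nonneg hn fun i => f (ω i)
  set c : ℝ := √(2 * L / (n - 1)) with hc
  have hc0 : 0 ≤ c := Real.sqrt_nonneg _
  have hcsq : c ^ 2 = 2 * L / (n - 1) := Real.sq_sqrt (by positivity)
  have hsv : 0 < √v := Real.sqrt_pos.2 hpos
  have hsv2 : √v ^ 2 = v := Real.sq_sqrt hv0
  -- Minimizes the exponent `m (s² v / 4 - s √v c)`, with value `-m c² ≤ -L`.
  set s : ℝ := 2 * c / √v with hs
  have hs0 : 0 ≤ s := by positivity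
  have hset : (univ.filter fun ω : Fin n → D => (ONBRA.empiricalVariance fun i => f (ω i)) <
        v - √v * c) = univ.filter fun ω : Fin n → D => -(m * (v - √v * c)) <
          -(m * ONBRA.empiricalVariance fun i => f (ω i)) := by
    ext ω
    simp [hm']
  rw [hset]
  refine (card_filter_lt_le_sum_exp _ _ s hs0).trans ?_
  refine (mul_le_mul_of_nonneg_right
    (sum_exp_neg_empiricalVariance_le e hn f hf0 hf1 hμ hv hs0) (Real.exp_pos _).le).trans ?_
  rw [mul_assoc, ← Real.exp_add]
  gcongr
  have h1 : (m : ℝ) * (-(s * v) + s ^ 2 * v / 4) + -(s * -(m * (v - √v * c))) = -(m * c ^ 2) := by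
    have key : s * √v = 2 * c := div_mul_cancel₀ _ hsv.ne'
    linear_combination (-m * s ^ 2 / 4) * hsv2 + m / 4 * (s * √v - 2 * c) * key
  rw [h1, hcsq, neg_le_neg_iff, mul_div_assoc', le_div_iff₀ hn1]
  nlinarith

/-! ### Empirical Bernstein inequality -/

/-- Solving the quadratic inequality gives `√v ≤ √V + c` with `c² = 2L/(n-1)`. The excess is at most
`c q ≤ c²`, and `2 + 1/3 = 7/3`. -/
theorem bernstein_with_empirical_variance_le {n : ℕ} (hn : 2 ≤ n) {v V L x : ℝ} (hv : 0 ≤ v)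
    (hV : 0 ≤ V) (hL : 0 < L) (hvV : v - √v * √(2 * L / (n - 1)) ≤ V)
    (hx : x ≤ √(2 * (n * v) * L) + L / 3) :
    1 / n * x ≤ √(2 * V * L / n) + 7 * L / (3 * (n - 1)) := by
  have hn' : (2 : ℝ) ≤ n := by exact_mod_cast hn
  have hn1 : 0 < (n : ℝ) - 1 := by linarith
  have hn0 : 0 < (n : ℝ) := by linarith
  set c : ℝ := √(2 * L / (n - 1)) with hc
  have hc0 : 0 ≤ c := Real.sqrt_nonneg _
  have hcsq : c ^ 2 = 2 * L / (n - 1) := Real.sq_sqrt (by positivity)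
  set q : ℝ := √(2 * L / n) with hq
  have hq0 : 0 ≤ q := Real.sqrt_nonneg _
  have hqsq : q ^ 2 = 2 * L / n := Real.sq_sqrt (by positivity)
  have hqc : q ≤ c := Real.sqrt_le_sqrt (by gcongr; linarith)
  have hsd : √v ≤ √V + c := by
    by_contra! h
    have h1 : √v ^ 2 = v := Real.sq_sqrt hv
    have h2 : √V ^ 2 = V := Real.sq_sqrt hV
    have h3 : 0 ≤ √V := Real.sqrt_nonneg _
    nlinarith
  have e1 : √(2 * (n * v) * L) = n * (√v * q) := by
    rw [show 2 * (n * v) * L = n ^ 2 * (v * (2 * L / n)) by field_simp,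
      Real.sqrt_mul (by positivity), Real.sqrt_sq hn0.le, Real.sqrt_mul hv]
  have e2 : √(2 * V * L / n) = √V * q := by
    rw [show 2 * V * L / n = V * (2 * L / n) by ring, Real.sqrt_mul hV]
  have h1 : 1 / n * x ≤ √v * q + L / (3 * n) := by
    rw [e1] at hx
    calc 1 / n * x ≤ 1 / n * (n * (√v * q) + L / 3) := by gcongr
      _ = _ := by field_simp
  have h2 : L / (3 * n) ≤ L / (3 * (n - 1)) := by
    gcongr; linarith
  have h3 : √v * q ≤ √V * q + c ^ 2 := by nlinarith
  rw [e2]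
  have h4 : c ^ 2 + L / (3 * (n - 1)) = 7 * L / (3 * (n - 1)) := by
    rw [hcsq]; field_simp; ring
  linarith

open Classical in
/-- **Empirical Bernstein inequality**, two-sided, for the uniform distribution on a finite set. -/
theorem card_filter_empirical_bernstein_le [Nonempty D] {n : ℕ} (hn : 2 ≤ n)
    (f : D → ℝ) (hf0 : ∀ d, 0 ≤ f d) (hf1 : ∀ d, f d ≤ 1) {μ L : ℝ}
    (hμ : μ = (∑ d, f d) / Fintype.card D) (hL : 0 < L) :
    (#{ω : Fin n → D | √(2 * (ONBRA.empiricalVariance fun i => f (ω i)) * L / n) +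
        7 * L / (3 * ((n : ℝ) - 1)) < |1 / (n : ℝ) * ∑ i, f (ω i) - μ|} : ℝ) ≤
      3 * ((Fintype.card D : ℝ) ^ n * Real.exp (-L)) := by
  have hn' : (2 : ℝ) ≤ n := by exact_mod_cast hn
  have hn0 : (n : ℝ) ≠ 0 := by linarith
  have hN : (0 : ℝ) < Fintype.card D := by exact_mod_cast Fintype.card_pos
  set v : ℝ := (∑ d, (f d - μ) ^ 2) / Fintype.card D with hv
  have hv0 : 0 ≤ v := by positivity
  have hμ0 : 0 ≤ μ := hμ ▸ div_nonneg (Finset.sum_nonneg fun d _ => hf0 d) hN.le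
  have hμ1 : μ ≤ 1 := by
    rw [hμ, div_le_one hN]
    simpa using Finset.sum_le_sum fun d (_ : d ∈ univ) => hf1 d
  have hmean : ∑ d, (f d - μ) = 0 := by
    rw [Finset.sum_sub_distrib, hμ]
    simp only [sum_const, card_univ, nsmul_eq_mul]
    field_simp
    ring
  have hmean' : ∑ d, (μ - f d) = 0 := by
    rw [← neg_eq_zero, ← Finset.sum_neg_distrib, ← hmean]
    simp
  have b1 := card_filter_sum_gt_le_bernstein n (fun d => f d - μ)
    (fun d => by linarith [hf1 d]) hmean hL hv
  have b2 := card_filter_sum_gt_le_bernstein n (fun d => μ - f d)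
    (fun d => by linarith [hf0 d]) hmean' hL
    (v := v) (by rw [hv]; congr 1; exact Finset.sum_congr rfl fun d _ => by ring)
  have b3 := card_filter_empiricalVariance_lt_le hn f hf0 hf1 hμ hv hL
  -- Off the upper tail `A`, the lower tail `B` and the variance event `C` the estimate holds; hence
  -- the factor `3`.
  set A := univ.filter fun ω : Fin n → D => √(2 * (n * v) * L) + L / 3 < ∑ i, (f (ω i) - μ)
  set B := univ.filter fun ω : Fin n → D => √(2 * (n * v) * L) + L / 3 < ∑ i, (μ - f (ω i))
  set C := univ.filter fun ω : Fin n → D => (ONBRA.empiricalVariance fun i => f (ω i)) <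
        v - √v * √(2 * L / (n - 1))
  have hsub : (univ.filter fun ω : Fin n → D =>
      √(2 * (ONBRA.empiricalVariance fun i => f (ω i)) * L / n) +
        7 * L / (3 * ((n : ℝ) - 1)) < |1 / (n : ℝ) * ∑ i, f (ω i) - μ|) ⊆ A ∪ B ∪ C := by
    intro ω hω
    contrapose! hω
    simp only [A, B, C, Finset.mem_union, Finset.mem_filter, Finset.mem_univ, true_and, not_or,
      not_lt] at hω ⊢
    obtain ⟨⟨h1, h2⟩, h3⟩ := hω
    have hV := ONBRA.empiricalVariance_nonneg hn fun i => f (ω i)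
    have c1 := bernstein_with_empirical_variance_le hn hv0 hV hL h3 h1
    have c2 := bernstein_with_empirical_variance_le hn hv0 hV hL h3 h2
    rw [Finset.sum_sub_distrib] at c1 c2
    simp only [sum_const, card_univ, Fintype.card_fin, nsmul_eq_mul] at c1 c2
    rw [mul_sub (1 / (n : ℝ)), ← mul_assoc, one_div_mul_cancel hn0, one_mul] at c1 c2
    rw [abs_le]
    constructor <;> linarith
  have hcard : (#(A ∪ B ∪ C) : ℝ) ≤ #A + #B + #C := by
    exact_mod_cast (Finset.card_union_le _ _).trans
      (Nat.add_le_add_right (Finset.card_union_le _ _) _)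
  have := Finset.card_le_card hsub
  have : (_ : ℝ) ≤ #(A ∪ B ∪ C) := Nat.cast_le.2 this
  linarith

end Counting

/-! ### From the sampling loop to a uniform vector of draws -/

theorem PMF.uniformOfFintype_bind_map_update {ι D : Type*} [Fintype ι] [DecidableEq ι] [Fintype D]
    [Nonempty D] (i : ι) :
    ((PMF.uniformOfFintype D).bind fun d =>
      (PMF.uniformOfFintype (ι → D)).map fun ω => Function.update ω i d) =
      PMF.uniformOfFintype (ι → D) := by
  classical
  ext ω
  -- Exchanging the fresh draw with coordinate `i` is a bijection, so every `ω` is hit by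
  -- `Fintype.card D` pairs.
  have hinv : Function.Involutive fun p : D × (ι → D) => (p.2 i, Function.update p.2 i p.1) := by
    rintro ⟨d, ω'⟩
    simp
  have hsum : ∑ d : D, ∑ ω' : ι → D,
      (if ω = Function.update ω' i d then (Fintype.card (ι → D) : ENNReal)⁻¹ else 0) =
        Fintype.card D * (Fintype.card (ι → D) : ENNReal)⁻¹ := by
    rw [← Fintype.sum_prod_type']
    refine (Equiv.sum_comp hinv.toPerm
      fun p : D × (ι → D) => if ω = p.2 then (Fintype.card (ι → D) : ENNReal)⁻¹ else 0).trans ?_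
    rw [Fintype.sum_prod_type]
    simp
  rw [PMF.bind_apply, tsum_fintype]
  simp only [PMF.map_apply, PMF.uniformOfFintype_apply, tsum_fintype]
  rw [← Finset.mul_sum, hsum, ← mul_assoc, ENNReal.inv_mul_cancel, one_mul]
  · simp
  · simp

/-- A loop whose iterations use independent uniform draws has the law of the deterministic loop
run on a vector of draws fixed in advance. -/
theorem PMF.foldlM_uniformOfFintype_eq_map {ι D β : Type*} [Fintype ι] [DecidableEq ι] [Fintype D]
    [Nonempty D] (F : ι → D → β → β) (l : List ι) (hl : l.Nodup) (b : β) :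
    l.foldlM (fun b i => (PMF.uniformOfFintype D).bind fun d => PMF.pure (F i d b)) b =
      (PMF.uniformOfFintype (ι → D)).map fun ω => l.foldl (fun b i => F i (ω i) b) b := by
  induction l generalizing b with
  | nil => exact (PMF.map_const _ _).symm
  | cons i l ih =>
    rw [List.nodup_cons] at hl
    rw [List.foldlM_cons]
    change PMF.bind _ _ = _
    rw [PMF.bind_bind]
    simp only [PMF.pure_bind, ih hl.2]
    -- Coordinate `i` is redrawn as `d`; the remaining iterations never read it, since `i` is not in
    -- the tail.
    conv_rhs => rw [← PMF.uniformOfFintype_bind_map_update (D := D) i, PMF.map_bind]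
    congr 1
    ext1 d
    rw [PMF.map_comp]
    congr 1
    ext1 ω
    simp only [Function.comp_apply, List.foldl_cons, Function.update_self]
    refine List.foldl_ext _ _ _ fun b j hj => ?_
    rw [Function.update_of_ne]
    rintro rfl
    exact hl.1 hj

/-! ### Rows of the matrix as samples with mean `b(v)` -/

namespace ONBRA

variable {V : Type*}

/-- The fraction `σ_{s,z}(v) / σ_{s,z}` of the optimal paths to which `v` is internal. -/
noncomputable def pathFraction (T : TemporalNetwork V) (c : PathCriterion) (v : V)
    (d : NodePair V) : ℝ :=
  (T.numPathsThrough c d.1.1 d.1.2 v : ℝ) / (T.numPaths c d.1.1 d.1.2 : ℝ)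

theorem pathFraction_nonneg (T : TemporalNetwork V) (c : PathCriterion) (v : V)
    (d : NodePair V) : 0 ≤ pathFraction T c v d := by
  unfold pathFraction
  positivity

theorem pathFraction_le_one (T : TemporalNetwork V) (c : PathCriterion) (v : V)
    (d : NodePair V) : pathFraction T c v d ≤ 1 := by
  refine div_le_one_of_le₀ ?_ (Nat.cast_nonneg _)
  exact_mod_cast Set.ncard_le_ncard (Set.sep_subset _ _) (T.finite_optimalPaths c _ _)

theorem pathFraction_eq_zero (T : TemporalNetwork V) (c : PathCriterion) (v : V) (d : NodePair V)
    (h : ¬ ∃ p ∈ T.optimalPaths c d.1.1 d.1.2, v ∈ TemporalNetwork.internalNodes d.1.1 d.1.2 p) :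
    pathFraction T c v d = 0 := by
  have : {p ∈ T.optimalPaths c d.1.1 d.1.2 |
      v ∈ TemporalNetwork.internalNodes d.1.1 d.1.2 p} = ∅ := by
    ext p
    simpa using fun hp hv => h ⟨p, hp, hv⟩
  simp [pathFraction, TemporalNetwork.numPathsThrough, this]

/-- An entry left untouched must already be `0`, which is then the correct fraction (`0 / 0 = 0`
when no path exists). -/
theorem processSample_apply_self {ℓ : ℕ} (T : TemporalNetwork V) (c : PathCriterion)
    (i : Fin ℓ) (d : NodePair V) (B : V → Fin ℓ → ℝ) (v : V) (hB : B v i = 0) :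
    processSample T c i d B v i = pathFraction T c v d := by
  unfold processSample
  by_cases h : ∃ p ∈ T.optimalPaths c d.1.1 d.1.2,
      v ∈ TemporalNetwork.internalNodes d.1.1 d.1.2 p
  · have hne : (T.optimalPaths c d.1.1 d.1.2).Nonempty := ⟨h.choose, h.choose_spec.1⟩
    rw [if_pos hne, if_pos ⟨rfl, h⟩, pathFraction]
  · rw [pathFraction_eq_zero T c v d h]
    split_ifs with h1
    · exact (if_neg fun h2 => h h2.2).trans hB
    · exact hB

theorem processSample_apply_of_ne {ℓ : ℕ} (T : TemporalNetwork V) (c : PathCriterion)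
    {i j : Fin ℓ} (d : NodePair V) (B : V → Fin ℓ → ℝ) (v : V) (hij : j ≠ i) :
    processSample T c i d B v j = B v j := by
  unfold processSample
  split_ifs with h1
  · exact if_neg fun h2 => hij h2.1
  · rfl

theorem foldl_processSample_apply {ℓ : ℕ} (T : TemporalNetwork V) (c : PathCriterion)
    (ω : Fin ℓ → NodePair V) (l : List (Fin ℓ)) (hl : l.Nodup) (B : V → Fin ℓ → ℝ)
    (hB : ∀ v, ∀ i ∈ l, B v i = 0) (v : V) (j : Fin ℓ) :
    l.foldl (fun B i => processSample T c i (ω i) B) B v j =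
      if j ∈ l then pathFraction T c v (ω j) else B v j := by
  induction l generalizing B with
  | nil => simp
  | cons i l ih =>
    rw [List.nodup_cons] at hl
    rw [List.foldl_cons, ih hl.2]
    · by_cases hji : j = i
      · subst hji
        simp [hl.1, processSample_apply_self T c j (ω j) B v (hB v j (by simp))]
      · simp [hji, processSample_apply_of_ne T c (ω i) B v hji]
    · intro v k hk
      rw [processSample_apply_of_ne T c (ω i) B v (by rintro rfl; exact hl.1 hk)]
      exact hB v k (by simp [hk])

theorem estimates_eq_map [Fintype V] [DecidableEq V] [Nontrivial V] (T : TemporalNetwork V)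
    (c : PathCriterion) (ℓ : ℕ) :
    estimates T c ℓ = (PMF.uniformOfFintype (Fin ℓ → NodePair V)).map
      fun ω v i => pathFraction T c v (ω i) := by
  unfold estimates
  rw [PMF.foldlM_uniformOfFintype_eq_map (fun i d B => processSample T c i d B) _
    (List.nodup_finRange ℓ)]
  congr 1
  ext ω v i
  rw [foldl_processSample_apply T c ω _ (List.nodup_finRange ℓ) _ (fun _ _ _ => rfl)]
  simp

theorem betweenness_eq_mean [Fintype V] [DecidableEq V] (T : TemporalNetwork V)
    (c : PathCriterion) (v : V) :
    T.betweenness c v = (∑ d, pathFraction T c v d) / Fintype.card (NodePair V) := by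
  have hcard : (Fintype.card (NodePair V) : ℝ) = Fintype.card V * (Fintype.card V - 1) := by
    have h : Fintype.card (NodePair V) = #(univ : Finset V).offDiag := by
      rw [Fintype.card_subtype]
      congr 1
      ext p
      simp
    rw [h, Finset.offDiag_card, card_univ, Nat.cast_sub (Nat.le_mul_self _)]
    push_cast
    ring
  rw [TemporalNetwork.betweenness, hcard, one_div, inv_mul_eq_div]
  rfl

end ONBRA

/-! ### Union bound and conclusion -/

theorem PMF.one_sub_le_toMeasure_real_map_uniformOfFintype {Ω β : Type*} [Fintype Ω] [Nonempty Ω]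
    [MeasurableSpace β] (F : Ω → β) (S : Set β) (bad : Finset Ω) (h : ∀ ω ∉ bad, F ω ∈ S) :
    1 - (#bad : ℝ) / Fintype.card Ω ≤ ((PMF.uniformOfFintype Ω).map F).toMeasure.real S := by
  classical
  have hΩ : (Fintype.card Ω : ℝ) ≠ 0 := by exact_mod_cast Fintype.card_ne_zero
  have h1 : (#badᶜ : ENNReal) / Fintype.card Ω ≤
      ((PMF.uniformOfFintype Ω).map F).toMeasure S := by
    -- Only a lower bound is needed, so `S` need not be measurable.
    refine le_trans ?_ (PMF.toOuterMeasure_apply_le_toMeasure_apply _ S)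
    rw [PMF.toOuterMeasure_map_apply, PMF.toOuterMeasure_uniformOfFintype_apply]
    gcongr
    rw [← Fintype.card_coe]
    refine Fintype.card_le_of_injective (fun ω => ⟨ω.1, h ω.1 (Finset.mem_compl.1 ω.2)⟩) ?_
    intro a b hab
    exact Subtype.ext (Subtype.mk.inj hab)
  have h2 := ENNReal.toReal_mono (MeasureTheory.measure_ne_top _ _) h1
  rw [ENNReal.toReal_div, ENNReal.toReal_natCast, ENNReal.toReal_natCast] at h2
  refine le_of_eq_of_le ?_ h2
  rw [Finset.card_compl, Nat.cast_sub (Finset.card_le_univ _), sub_div, div_self hΩ]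

theorem corollary1 {V : Type*} [Fintype V] [DecidableEq V] [Nontrivial V]
    (T : TemporalNetwork V) (c : PathCriterion) (η : ℝ) (hη₀ : 0 < η) (hη₁ : η < 1)
    (ℓ : ℕ) (hℓ : 2 ≤ ℓ) :
    1 - η < (ONBRA.onbra T c η ℓ).toMeasure.real
      {out : ℝ × (V → ℝ) | (⨆ v : V, |out.2 v - T.betweenness c v|) ≤ out.1} := by
  classical
  have hV : (2 : ℝ) ≤ Fintype.card V := by exact_mod_cast Fintype.one_lt_card
  have hV0 : (0 : ℝ) < Fintype.card V := by linarith
  set L : ℝ := Real.log (4 * (Fintype.card V : ℝ) / η) with hLdef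
  have hL : 0 < L := Real.log_pos (by rw [lt_div_iff₀ hη₀]; linarith)
  have hexp : Real.exp (-L) = η / (4 * Fintype.card V) := by
    rw [Real.exp_neg, hLdef, Real.exp_log (by positivity), inv_div]
  have hN : (0 : ℝ) < (Fintype.card (NodePair V) : ℝ) ^ ℓ := by
    have : 0 < Fintype.card (NodePair V) := Fintype.card_pos
    positivity
  set bad : V → Finset (Fin ℓ → NodePair V) := fun v => univ.filter fun ω =>
    √(2 * (ONBRA.empiricalVariance fun i => ONBRA.pathFraction T c v (ω i)) * L / ℓ) +
      7 * L / (3 * ((ℓ : ℝ) - 1)) <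
        |1 / (ℓ : ℝ) * ∑ i, ONBRA.pathFraction T c v (ω i) - T.betweenness c v| with hbad
  have hbadcard : ∀ v, (#(bad v) : ℝ) ≤
      3 * ((Fintype.card (NodePair V) : ℝ) ^ ℓ * Real.exp (-L)) := fun v =>
    card_filter_empirical_bernstein_le hℓ _ (ONBRA.pathFraction_nonneg T c v)
      (ONBRA.pathFraction_le_one T c v) (ONBRA.betweenness_eq_mean T c v) hL
  -- There are `n` nodes with failure `3 η / (4 n)` each; the spare `η / 4` makes the final
  -- inequality strict.
  have hunion : (#(univ.biUnion bad) : ℝ) / Fintype.card (Fin ℓ → NodePair V) ≤ 3 / 4 * η := by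
    have h1 : (#(univ.biUnion bad) : ℝ) ≤ ∑ v, (#(bad v) : ℝ) := by
      exact_mod_cast Finset.card_biUnion_le
    have h2 := h1.trans (Finset.sum_le_sum fun v _ => hbadcard v)
    rw [Finset.sum_const, card_univ, nsmul_eq_mul, hexp] at h2
    rw [Fintype.card_fun, Fintype.card_fin, Nat.cast_pow, div_le_iff₀ hN]
    refine h2.trans_eq ?_
    field_simp
  have hlaw : ONBRA.onbra T c η ℓ = (PMF.uniformOfFintype (Fin ℓ → NodePair V)).map fun ω =>
      (ONBRA.accuracy η fun v i => ONBRA.pathFraction T c v (ω i),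
        ONBRA.average fun v i => ONBRA.pathFraction T c v (ω i)) := by
    rw [ONBRA.onbra, ONBRA.estimates_eq_map, PMF.bind_map]
    exact PMF.bind_pure_comp _ _
  rw [hlaw]
  refine lt_of_lt_of_le ?_ (PMF.one_sub_le_toMeasure_real_map_uniformOfFintype _ _
    (univ.biUnion bad) ?_)
  · linarith
  · intro ω hω
    rw [Set.mem_ofPred_eq, ONBRA.accuracy]
    -- The suprema are compared node by node; the right-hand family is bounded because `V` is
    -- finite.
    refine ciSup_mono (Set.finite_range _).bddAbove fun v => ?_
    have hv : ω ∉ bad v := fun h => hω (Finset.mem_biUnion.2 ⟨v, mem_univ v, h⟩)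
    simpa [hbad, ONBRA.average] using hv
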